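/- Consider the repeated posted-price auction with $T \in \mathbb{N}_+$ rounds. At each round $t = 1,\dots,T$ the seller posts a price $p_t \in [0,1]$, the buyer's valuation $v_t$ is drawn independently from a fixed distribution $\mathcal{V}$, unknown to the seller, whose support is a finite subset of $(0,1)$ with $n$ elements, and the buyer buys if and only if $v_t \ge p_t$. The seller does not observe $v_t$, but only whether the item was sold; the price $p_t$ is a deterministic function of the prices posted and the sale outcomes observed in rounds $1,\dots,t-1$. Let $u(p) = p \cdot \mathbb{P}_{v \sim \mathcal{V}}\{v \ge p\}$ be the seller's expected utility for price $p$, and let the regret against an optimal fixed price be $$R_T = T \cdot \max_{p \in [0,1]} u(p) - \mathbb{E}\Big[\sum_{t=1}^{T} u(p_t)\Big].$$ Then there is a pricing algorithm, taking as input only the number of rounds $T$, whose regret is $\widetilde{\mathcal{O}}(\sqrt{nT})$ uniformly over all instances. That is, there are universal constants $C, k$ such that, for every $T \ge 1$, every $n$ and every distribution $\mathcal{V}$ with exactly $n$ support points, all in $(0,1)$, $$R_T \le C \sqrt{nT}\,(1 + \log T)^k .$$ In particular the algorithm knows neither $\mathcal{V}$ nor $n$, and the bound depends on $\mathcal{V}$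 only through $n$. -/

import Mathlib

open MeasureTheory

namespace PostedPrice

/-- The sequence of past (posted price, item sold or not) pairs, most recent round first. -/
abbrev History := List (unitInterval × Bool)

/-- A deterministic pricing policy: the price in `[0, 1]` posted after a given history.
Its restriction to histories of length `t` is the pricing rule of round `t + 1`. -/
abbrev Policy := History → unitInterval

/-- The history after `t` rounds when the buyers' valuations are `v 0, v 1, …`. In each round the
seller posts the policy's price `p` and only learns whether the buyer buys, i.e. whether
`p ≤ v t`. -/
noncomputable def history (π : Policy) (v : ℕ → ℝ) : ℕ → History
  | 0 => []
  | t + 1 =>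
    let H := history π v t
    (π H, decide ((π H : ℝ) ≤ v t)) :: H

/-- The price posted in round `t` (rounds are numbered `0, 1, 2, …`). -/
noncomputable def price (π : Policy) (v : ℕ → ℝ) (t : ℕ) : unitInterval :=
  π (history π v t)

/-- The seller's expected utility `u(p) = p · ℙ(v ≥ p)` from posting price `p` to a buyer with
valuation distribution `V`. -/
noncomputable def utility (V : PMF ℝ) (p : unitInterval) : ℝ :=
  (p : ℝ) * V.toMeasure.real (Set.Ici (p : ℝ))

/-- The expected utility of an optimal fixed price. -/
noncomputable def OPT (V : PMF ℝ) : ℝ :=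
  ⨆ p : unitInterval, utility V p

/-- The (pseudo-)regret of the policy `π` over `T` rounds, against an optimal fixed price, when
the valuations are drawn independently from `V`. -/
noncomputable def regret (π : Policy) (V : PMF ℝ) (T : ℕ) : ℝ :=
  T * OPT V -
    ∫ v, ∑ t ∈ Finset.range T, utility V (price π v t)
      ∂(Measure.infinitePi fun _ : ℕ => V.toMeasure)

end PostedPrice

/-! Prices are restricted to the grid of mesh `2 ^ (-L)`, `L = Nat.clog 2 T`, which costs at most 1
in total. Dyadic blocks of the grid carry a lower bound `base` on the demand at their last index and
an uncertainty `width`; the algorithm always tests a block of maximal optimistic utility `last *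
upper`. Within a block only indices from `probe` on can beat `last`, so both tested prices lose at
most `2 * width`.

A test spends about `K / width ^ 2` rounds on each price. If the two demands look close, the
uncertainty halves; otherwise demand really drops, the block contains a support point, and it is
split. Hence splits occur only around the `n` support points, and a potential bounds the number of
tests by `(L + 2) * (1 + 2 * L * n)` (`Node.potential_refine`). Every test contributes at most `2 *
K` to the sum over rounds of `width ^ 2`, so by Cauchy–Schwarz the loss is of order `√(T * K * L ^ 2
* n)` (`sum_loss_le`).

This holds surely when all windows of sales are accurate. By Hoeffding and a union bound
(`exists_measurableSet_accurate`) that fails with probability at most `1 / T` for `K` of order `L`.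
-/

namespace PostedPrice

/-! ### Blocks of grid prices -/

/-- A block of `2 ^ depth` consecutive grid indices, starting at `left`, together with a lower
bound `base` on the demand at its last index and a precision level. -/
structure Node where
  left : ℕ
  depth : ℕ
  level : ℕ
  base : ℝ

namespace Node

/-- The last grid index of the block. -/
def last (ν : Node) : ℕ := ν.left + 2 ^ ν.depth - 1

/-- The uncertainty about the demand in the block. -/
noncomputable def width (ν : Node) : ℝ := (1 / 2) ^ ν.level

/-- Optimistic bound on the demand at a best price of the block. -/
noncomputable def upper (ν : Node) : ℝ := ν.base + ν.width

/-- Optimistic bound on the utility in the block, in grid units. -/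
noncomputable def index (ν : Node) : ℝ := ν.last * ν.upper

/-- The first index of the block that may still be as good as the last one. -/
noncomputable def probe (ν : Node) : ℕ := max ν.left ⌈ν.last * ν.base / ν.upper⌉₊

/-- Number of rounds during which each of the two prices `probe` and `last` is tested. -/
def rounds (K : ℕ) (ν : Node) : ℕ := K * 4 ^ ν.level

/-- The nodes replacing `ν` after a test with `sa` sales at `probe` and `sb` sales at `last`. -/
noncomputable def refine (K : ℕ) (ν : Node) (sa sb : ℕ) : List Node :=
  -- With estimates accurate to `width / 8`, a drop above `width / 4` is genuine; otherwise the
  -- uncertainty is at most `width / 8 + width / 4 + width / 8`, the next width.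
  if (sa : ℝ) / ν.rounds K - sb / ν.rounds K ≤ ν.width / 4 then
    [⟨ν.left, ν.depth, ν.level + 1, max 0 (sb / ν.rounds K - ν.width / 8)⟩]
  else
    [⟨ν.left, ν.depth - 1, ν.level, ν.base⟩,
      ⟨ν.left + 2 ^ (ν.depth - 1), ν.depth - 1, ν.level, ν.base⟩]

/-- The demand bounds claimed by a node are valid at the last index. -/
structure Valid (L : ℕ) (D : ℕ → ℝ) (ν : Node) : Prop where
  le_size : ν.left + 2 ^ ν.depth ≤ 2 ^ L
  base_nonneg : 0 ≤ ν.base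
  base_le : ν.base ≤ D ν.last
  level_le : ν.level ≤ L + 1

/-- The block contains the index `o`, and the optimistic bound is valid there. -/
structure Covers (D : ℕ → ℝ) (o : ℕ) (ν : Node) : Prop where
  left_le : ν.left ≤ o
  le_last : o ≤ ν.last
  le_upper : D o ≤ ν.upper

/-- Number of points of `S` in the block, the grid having mesh `2 ^ (-L)`. -/
noncomputable def jumps (L : ℕ) (S : Finset ℝ) (ν : Node) : ℕ :=
  (S.filter fun s => (ν.left : ℝ) / 2 ^ L ≤ s ∧ s < (ν.last : ℝ) / 2 ^ L).card

/-- Bounds the number of tests in the block. -/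
noncomputable def potential (L : ℕ) (S : Finset ℝ) (ν : Node) : ℕ :=
  -- The `L + 2` keeps the first factor positive up to level `L + 1`; the factor 2 pays for both the
  -- extra block and the test when a block is split.
  (L + 2 - ν.level) * (1 + 2 * ν.depth * ν.jumps L S)

lemma width_pos (ν : Node) : 0 < ν.width := by unfold width; positivity

lemma width_sq (ν : Node) : ν.width ^ 2 = (1 / 4) ^ ν.level := by
  unfold width; rw [← pow_mul, mul_comm, pow_mul]; norm_num

lemma rounds_mul_width_sq (K : ℕ) (ν : Node) : (ν.rounds K : ℝ) * ν.width ^ 2 = K := by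
  rw [width_sq, rounds]; push_cast
  rw [mul_assoc, ← mul_pow]; norm_num

lemma rounds_pos {K : ℕ} (hK : 0 < K) (ν : Node) : 0 < ν.rounds K := by
  unfold rounds; positivity

lemma left_le_last (ν : Node) : ν.left ≤ ν.last := by
  have : 0 < 2 ^ ν.depth := by positivity
  unfold last; omega

lemma left_le_probe (ν : Node) : ν.left ≤ ν.probe := le_max_left _ _

lemma upper_pos {ν : Node} (h : 0 ≤ ν.base) : 0 < ν.upper := by
  have := ν.width_pos; unfold upper; linarith

lemma probe_le_last {ν : Node} (h : 0 ≤ ν.base) : ν.probe ≤ ν.last := by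
  refine max_le ν.left_le_last (Nat.ceil_le.2 ?_)
  rw [div_le_iff₀ (upper_pos h)]
  have := ν.width_pos
  unfold upper
  nlinarith [Nat.cast_nonneg (α := ℝ) ν.last]

lemma last_mul_base_le {ν : Node} (h : 0 ≤ ν.base) :
    ν.last * ν.base ≤ ν.probe * ν.upper := by
  rw [← div_le_iff₀ (upper_pos h)]
  exact (Nat.le_ceil _).trans (by exact_mod_cast le_max_right _ _)

/-- Pruning: an index `i` of the block with `i * upper < last * base` is worse than `last`, so
`probe` never skips an optimum covered by the block. -/
lemma probe_le {ν : Node} (h : 0 ≤ ν.base) {o : ℕ} (ho : ν.left ≤ o)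
    (hu : ν.last * ν.base ≤ o * ν.upper) : ν.probe ≤ o :=
  max_le ho (Nat.ceil_le.2 ((div_le_iff₀ (upper_pos h)).2 hu))

lemma Valid.last_lt {L : ℕ} {D : ℕ → ℝ} {ν : Node} (h : ν.Valid L D) : ν.last < 2 ^ L := by
  have h1 := h.le_size
  have : 0 < 2 ^ ν.depth := by positivity
  unfold last; omega

lemma Valid.last_loss {L : ℕ} {D : ℕ → ℝ} {ν : Node} (h : ν.Valid L D) :
    ν.index - ν.last * D ν.last ≤ 2 ^ L * (2 * ν.width) := by
  have h1 : (ν.last : ℝ) ≤ 2 ^ L := by exact_mod_cast h.last_lt.le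
  have h2 := mul_le_mul_of_nonneg_left h.base_le (Nat.cast_nonneg (α := ℝ) ν.last)
  have h3 := mul_le_mul_of_nonneg_right h1 ν.width_pos.le
  have : 0 ≤ 2 ^ L * ν.width := mul_nonneg (by positivity) ν.width_pos.le
  unfold index upper
  linarith

/-- `probe * upper` is at least `last * base`, so replacing `last` by `probe` costs one more
`width`, as does replacing `upper` by `base`. -/
lemma Valid.probe_loss {L : ℕ} {D : ℕ → ℝ} (hD : Antitone D) {ν : Node} (h : ν.Valid L D) :
    ν.index - ν.probe * D ν.probe ≤ 2 ^ L * (2 * ν.width) := by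
  have h1 : (ν.last : ℝ) ≤ 2 ^ L := by exact_mod_cast h.last_lt.le
  have h4 : (ν.probe : ℝ) ≤ ν.last := by exact_mod_cast probe_le_last h.base_nonneg
  have h2 := mul_le_mul_of_nonneg_left (h.base_le.trans (hD (probe_le_last h.base_nonneg)))
    (Nat.cast_nonneg (α := ℝ) ν.probe)
  have h3 := mul_le_mul_of_nonneg_right h1 ν.width_pos.le
  have h5 := mul_le_mul_of_nonneg_right h4 ν.width_pos.le
  have h6 := last_mul_base_le h.base_nonneg
  unfold index
  unfold upper at *
  linarith

/-! ### Effect of one test on a block -/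

section Refine

variable {L K : ℕ} {D : ℕ → ℝ} {ν : Node} {sa sb : ℕ} {o : ℕ} {S : Finset ℝ}

lemma abs_div_rounds_sub_le (hK : 0 < K) {s : ℕ} {d : ℝ}
    (hs : |(s : ℝ) - ν.rounds K * d| ≤ ν.rounds K * (ν.width / 8)) :
    |(s : ℝ) / ν.rounds K - d| ≤ ν.width / 8 := by
  have hm : (0 : ℝ) < ν.rounds K := by exact_mod_cast rounds_pos hK ν
  have : (s : ℝ) / ν.rounds K - d = (s - ν.rounds K * d) / ν.rounds K := by field_simp
  rw [this, abs_div, abs_of_pos hm, div_le_iff₀ hm]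
  linarith

lemma demand_lt_of_not_drop_le (hK : 0 < K) (hD : Antitone D)
    (ha : |(sa : ℝ) - ν.rounds K * D ν.probe| ≤ ν.rounds K * (ν.width / 8))
    (hb : |(sb : ℝ) - ν.rounds K * D ν.last| ≤ ν.rounds K * (ν.width / 8))
    (hr : ¬ (sa : ℝ) / ν.rounds K - sb / ν.rounds K ≤ ν.width / 4) :
    D ν.last < D ν.left := by
  have ha' := abs_le.1 (abs_div_rounds_sub_le hK ha)
  have hb' := abs_le.1 (abs_div_rounds_sub_le hK hb)
  have := hD ν.left_le_probe
  linarith [ha'.2, hb'.1]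

lemma depth_pos_of_lt (h : D ν.last < D ν.left) : 0 < ν.depth := by
  rcases Nat.eq_zero_or_pos ν.depth with h0 | h0
  · have : ν.last = ν.left := by simp [last, h0]
    rw [this] at h; exact absurd h (lt_irrefl _)
  · exact h0

/-- Halves inherit `base` because demand is no smaller at earlier indices; after a halving of the
width, `base` is the lower confidence bound at `last`. -/
lemma valid_of_mem_refine (hK : 0 < K) (hD : Antitone D) (hD0 : ∀ i, 0 ≤ D i)
    (h : ν.Valid L D) (hl : ν.level ≤ L)
    (ha : |(sa : ℝ) - ν.rounds K * D ν.probe| ≤ ν.rounds K * (ν.width / 8))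
    (hb : |(sb : ℝ) - ν.rounds K * D ν.last| ≤ ν.rounds K * (ν.width / 8)) :
    ∀ μ ∈ ν.refine K sa sb, μ.Valid L D := by
  intro μ hμ
  have hb' := abs_le.1 (abs_div_rounds_sub_le hK hb)
  unfold refine at hμ
  split_ifs at hμ with hc
  · rw [List.mem_singleton] at hμ
    subst hμ
    exact ⟨h.le_size, le_max_left _ _, max_le (hD0 _) (by
      change _ ≤ D ν.last
      linarith [hb'.2]), Nat.succ_le_succ hl⟩
  · obtain ⟨d, hd⟩ : ∃ d, ν.depth = d + 1 := ⟨ν.depth - 1, by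
      have := depth_pos_of_lt (demand_lt_of_not_drop_le hK hD ha hb hc)
      omega⟩
    have h1 := h.le_size
    have hp : 2 ^ ν.depth = 2 ^ d + 2 ^ d := by rw [hd, pow_succ]; ring
    have hp' : 0 < 2 ^ d := by positivity
    have hd' : ν.depth - 1 = d := by omega
    simp only [List.mem_cons, List.not_mem_nil, or_false] at hμ
    rcases hμ with rfl | rfl
    · refine ⟨?_, h.base_nonneg, h.base_le.trans (hD ?_), h.level_le⟩
      · change ν.left + 2 ^ (ν.depth - 1) ≤ _
        rw [hd']; omega
      · change ν.left + 2 ^ (ν.depth - 1) - 1 ≤ ν.left + 2 ^ ν.depth - 1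
        rw [hd']; omega
    · refine ⟨?_, h.base_nonneg, h.base_le.trans (hD ?_), h.level_le⟩
      · change ν.left + 2 ^ (ν.depth - 1) + 2 ^ (ν.depth - 1) ≤ _
        rw [hd']; omega
      · change ν.left + 2 ^ (ν.depth - 1) + 2 ^ (ν.depth - 1) - 1 ≤ ν.left + 2 ^ ν.depth - 1
        rw [hd']; omega

/-- Since `o` beats `last`, pruning gives `probe ≤ o`, so `D o ≤ D probe`, and a small measured drop
bounds `D o` by the new `upper`. A split keeps `upper` and puts `o` in one half. -/
lemma exists_covers_refine (hK : 0 < K) (hD : Antitone D)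
    (h : ν.Valid L D) (ho : ν.last * D ν.last ≤ o * D o) (hc : ν.Covers D o)
    (ha : |(sa : ℝ) - ν.rounds K * D ν.probe| ≤ ν.rounds K * (ν.width / 8))
    (hb : |(sb : ℝ) - ν.rounds K * D ν.last| ≤ ν.rounds K * (ν.width / 8)) :
    ∃ μ ∈ ν.refine K sa sb, μ.Covers D o := by
  have ha' := abs_le.1 (abs_div_rounds_sub_le hK ha)
  unfold refine
  split_ifs with hd
  · refine ⟨_, List.mem_singleton_self _, hc.left_le, hc.le_last, ?_⟩
    have hp : ν.probe ≤ o := probe_le h.base_nonneg hc.left_le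
      ((mul_le_mul_of_nonneg_left h.base_le (Nat.cast_nonneg _)).trans
        (ho.trans (mul_le_mul_of_nonneg_left hc.le_upper (Nat.cast_nonneg _))))
    have h1 := hD hp
    change D o ≤ max 0 ((sb : ℝ) / ν.rounds K - ν.width / 8) + (1 / 2) ^ (ν.level + 1)
    have h2 : ((1 : ℝ) / 2) ^ (ν.level + 1) = ν.width / 2 := by rw [pow_succ]; unfold width; ring
    rw [h2]
    linarith [le_max_right 0 ((sb : ℝ) / ν.rounds K - ν.width / 8), ha'.1]
  · have hdp := depth_pos_of_lt (demand_lt_of_not_drop_le hK hD ha hb hd)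
    obtain ⟨d, hd⟩ : ∃ d, ν.depth = d + 1 := ⟨ν.depth - 1, by omega⟩
    have hp : 2 ^ ν.depth = 2 ^ d + 2 ^ d := by rw [hd, pow_succ]; ring
    have hp' : 0 < 2 ^ d := by positivity
    have hd' : ν.depth - 1 = d := by omega
    have h1 := hc.left_le
    have h2 := hc.le_last
    unfold last at h2
    rw [hd']
    rcases lt_or_ge o (ν.left + 2 ^ d) with hlt | hge
    · refine ⟨_, List.mem_cons_self, h1, ?_, hc.le_upper⟩
      change o ≤ ν.left + 2 ^ d - 1
      omega
    · refine ⟨_, List.mem_cons_of_mem _ (List.mem_singleton_self _), hge, ?_, hc.le_upper⟩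
      change o ≤ ν.left + 2 ^ d + 2 ^ d - 1
      omega

/-- Halving the width lowers the first factor. In a split the support points are shared between the
halves and `depth` falls by one; as there is at least one such point `j ≥ 1`, `3 + 2 * d * j ≤ 1 + 2
* (d + 1) * j`. -/
lemma potential_refine (hK : 0 < K) (hD : Antitone D)
    (hS : ∀ i j, D j < D i → ∃ s ∈ S, (i : ℝ) / 2 ^ L ≤ s ∧ s < (j : ℝ) / 2 ^ L)
    (hl : ν.level ≤ L)
    (ha : |(sa : ℝ) - ν.rounds K * D ν.probe| ≤ ν.rounds K * (ν.width / 8))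
    (hb : |(sb : ℝ) - ν.rounds K * D ν.last| ≤ ν.rounds K * (ν.width / 8)) :
    ((ν.refine K sa sb).map (potential L S)).sum + 1 ≤ ν.potential L S := by
  unfold refine
  split_ifs with hc
  · simp only [List.map_cons, List.map_nil, List.sum_cons, List.sum_nil, add_zero]
    change (L + 2 - (ν.level + 1)) * (1 + 2 * ν.depth * ν.jumps L S) + 1
      ≤ (L + 2 - ν.level) * (1 + 2 * ν.depth * ν.jumps L S)
    obtain ⟨q, hq⟩ : ∃ q, L + 2 - ν.level = q + 1 := ⟨L + 1 - ν.level, by omega⟩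
    have : L + 2 - (ν.level + 1) = q := by omega
    rw [hq, this]
    nlinarith
  · have hlt := demand_lt_of_not_drop_le hK hD ha hb hc
    have hdp := depth_pos_of_lt hlt
    obtain ⟨d, hd⟩ : ∃ d, ν.depth = d + 1 := ⟨ν.depth - 1, by omega⟩
    have hp : 2 ^ ν.depth = 2 ^ d + 2 ^ d := by rw [hd, pow_succ]; ring
    have hp' : 0 < 2 ^ d := by positivity
    have hd' : ν.depth - 1 = d := by omega
    rw [hd']
    set ν₁ : Node := ⟨ν.left, d, ν.level, ν.base⟩ with hν₁
    set ν₂ : Node := ⟨ν.left + 2 ^ d, d, ν.level, ν.base⟩ with hν₂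
    have hl1 : ν₁.last ≤ ν.left + 2 ^ d := by simp [last, hν₁]
    have hl2 : ν₂.last = ν.last := by simp only [last, hν₂]; omega
    have hl3 : ν.left + 2 ^ d ≤ ν.last := by simp only [last]; omega
    have hL : (0 : ℝ) < 2 ^ L := by positivity
    have e1 : (ν₁.last : ℝ) / 2 ^ L ≤ ((ν.left + 2 ^ d : ℕ) : ℝ) / 2 ^ L := by gcongr
    have e3 : ((ν.left + 2 ^ d : ℕ) : ℝ) / 2 ^ L ≤ (ν.last : ℝ) / 2 ^ L := by gcongr
    have e4 : (ν.left : ℝ) / 2 ^ L ≤ ((ν.left + 2 ^ d : ℕ) : ℝ) / 2 ^ L := by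
      gcongr; omega
    have hadd : ν₁.jumps L S + ν₂.jumps L S ≤ ν.jumps L S := by
      unfold jumps
      rw [← Finset.card_union_of_disjoint]
      · refine Finset.card_le_card fun s hs => ?_
        rw [hl2] at hs
        simp only [Finset.mem_union, Finset.mem_filter] at hs ⊢
        rcases hs with ⟨h1, h2, h3⟩ | ⟨h1, h2, h3⟩
        · exact ⟨h1, h2, by linarith⟩
        · exact ⟨h1, e4.trans h2, h3⟩
      · rw [Finset.disjoint_left]
        intro s h1 h2
        simp only [Finset.mem_filter] at h1 h2
        have h3 : ((ν.left + 2 ^ d : ℕ) : ℝ) / 2 ^ L ≤ s := h2.2.1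
        linarith [h1.2.2]
    have hpos : 1 ≤ ν.jumps L S := by
      obtain ⟨s, hs, h1, h2⟩ := hS _ _ hlt
      exact Finset.card_pos.2 ⟨s, Finset.mem_filter.2 ⟨hs, h1, h2⟩⟩
    simp only [List.map_cons, List.map_nil, List.sum_cons, List.sum_nil, add_zero]
    change (L + 2 - ν.level) * (1 + 2 * d * ν₁.jumps L S)
      + (L + 2 - ν.level) * (1 + 2 * d * ν₂.jumps L S) + 1
      ≤ (L + 2 - ν.level) * (1 + 2 * ν.depth * ν.jumps L S)
    have hq : 1 ≤ L + 2 - ν.level := by omega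
    rw [← mul_add, hd]
    calc _ ≤ (L + 2 - ν.level) * (1 + 2 * d * ν₁.jumps L S + (1 + 2 * d * ν₂.jumps L S))
          + (L + 2 - ν.level) := by omega
      _ = (L + 2 - ν.level) * (3 + 2 * d * (ν₁.jumps L S + ν₂.jumps L S)) := by ring
      _ ≤ (L + 2 - ν.level) * (3 + 2 * d * ν.jumps L S) := by gcongr
      _ ≤ _ := Nat.mul_le_mul_left _ (by nlinarith)

end Refine

end Node

/-! ### The algorithm as a state machine -/

/-- The state of the algorithm: the node under test, the other nodes, the number of rounds of the
current test, and the number of sales at the two tested prices. -/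
structure State where
  cur : Node
  rest : List Node
  cnt : ℕ
  sa : ℕ
  sb : ℕ

/-- The block of all grid indices below `2 ^ L`. -/
noncomputable def rootNode (L : ℕ) : Node := ⟨0, L, 0, 0⟩

/-- The initial state. -/
noncomputable def initState (L : ℕ) : State := ⟨rootNode L, [], 0, 0, 0⟩

lemma exists_perm_index_le (l : List Node) (hl : l ≠ []) :
    ∃ c r, (c :: r).Perm l ∧ ∀ y ∈ r, y.index ≤ c.index := by
  induction l with
  | nil => exact absurd rfl hl
  | cons a l ih =>
    rcases eq_or_ne l [] with rfl | hne
    · exact ⟨a, [], List.Perm.refl _, by simp⟩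
    · obtain ⟨c, r, hp, hm⟩ := ih hne
      have hm' : ∀ y ∈ l, y.index ≤ c.index := fun y hy => by
        rcases List.mem_cons.1 (hp.mem_iff.2 hy) with rfl | h
        · exact le_rfl
        · exact hm y h
      rcases le_total c.index a.index with h | h
      · exact ⟨a, l, List.Perm.refl _, fun y hy => (hm' y hy).trans h⟩
      · refine ⟨c, a :: r, (List.Perm.swap _ _ _).trans (hp.cons a), fun y hy => ?_⟩
        rcases List.mem_cons.1 hy with rfl | h'
        · exact h
        · exact hm y h'

open Classical in
/-- Start a test of a node of maximal index. -/
noncomputable def restart (L : ℕ) (l : List Node) : State :=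
  if h : ∃ c r, (c :: r).Perm l ∧ ∀ y ∈ r, y.index ≤ c.index then
    ⟨h.choose, h.choose_spec.choose, 0, 0, 0⟩
  -- Default for the empty list, which never occurs in a run with accurate samples.
  else initState L

lemma restart_spec (L : ℕ) (l : List Node) (hl : l ≠ []) :
    ((restart L l).cur :: (restart L l).rest).Perm l ∧
      (∀ y ∈ (restart L l).rest, y.index ≤ (restart L l).cur.index) ∧
      (restart L l).cnt = 0 ∧ (restart L l).sa = 0 ∧ (restart L l).sb = 0 := by
  have h := exists_perm_index_le l hl
  unfold restart
  rw [dif_pos h]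
  exact ⟨h.choose_spec.choose_spec.1, h.choose_spec.choose_spec.2, rfl, rfl, rfl⟩

namespace State

/-- The grid index of the price posted in a state. -/
noncomputable def query (K : ℕ) (s : State) : ℕ :=
  if s.cnt < s.cur.rounds K then s.cur.probe else s.cur.last

/-- Record a sale outcome, without ending the test. -/
noncomputable def record (K : ℕ) (s : State) (x : Bool) : State :=
  { s with
    cnt := s.cnt + 1
    sa := s.sa + if s.cnt < s.cur.rounds K ∧ x = true then 1 else 0
    sb := s.sb + if ¬ s.cnt < s.cur.rounds K ∧ x = true then 1 else 0 }

/-- The state after a further sale outcome. -/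
noncomputable def step (L K : ℕ) (s : State) (x : Bool) : State :=
  if s.cnt + 1 < 2 * s.cur.rounds K then s.record K x
  else restart L (s.cur.refine K (s.record K x).sa (s.record K x).sb ++ s.rest)

end State

/-! ### Deterministic analysis of a run -/

/-- Number of sales in `m` rounds from round `τ` on. -/
def sales (z : ℕ → Bool) (τ m : ℕ) : ℕ := ∑ j ∈ Finset.range m, if z (τ + j) = true then 1 else 0

/-- The properties maintained by the algorithm; `E` is the sum of the squared widths so far. -/
structure Invariant (L K : ℕ) (D : ℕ → ℝ) (S : Finset ℝ) (o : ℕ) (y : ℕ → ℕ → Bool)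
    (s : State) (t : ℕ) (E : ℝ) : Prop where
  cnt_lt : s.cnt < 2 * s.cur.rounds K
  counts : ∃ τ, τ + s.cnt = t ∧
    s.sa = sales (y s.cur.probe) τ (min s.cnt (s.cur.rounds K)) ∧
    s.sb = sales (y s.cur.last) (τ + s.cur.rounds K) (s.cnt - s.cur.rounds K)
  valid : ∀ ν ∈ s.cur :: s.rest, ν.Valid L D
  covers : ∃ ν ∈ s.cur :: s.rest, ν.Covers D o
  index_le : ∀ ν ∈ s.rest, ν.index ≤ s.cur.index
  -- Each completed test is paid for by one unit of potential; the last term is the part of the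
  -- current test not yet paid for.
  energy : E + 2 * K * (((s.cur :: s.rest).map (Node.potential L S)).sum : ℕ)
    ≤ 2 * K * (rootNode L).potential L S + s.cnt * s.cur.width ^ 2

/-- All empirical demands along the windows used by the algorithm are accurate. -/
def Accurate (L K : ℕ) (D : ℕ → ℝ) (y : ℕ → ℕ → Bool) : Prop :=
  -- Windows are fixed in advance rather than chosen adaptively, so that each is a sum of
  -- independent variables; every completed test within the horizon uses two of them.
  ∀ i < 2 ^ L, ∀ τ < 2 ^ L, ∀ r < 2 ^ L,
    |(sales (y i) τ (K * 4 ^ r) : ℝ) - (K * 4 ^ r : ℕ) * D i| ≤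
      (K * 4 ^ r : ℕ) * ((1 / 2) ^ r / 8)

section Run

variable {L K : ℕ} {D : ℕ → ℝ} {S : Finset ℝ} {o : ℕ} {y : ℕ → ℕ → Bool}

lemma sales_succ (z : ℕ → Bool) (τ m : ℕ) :
    sales z τ (m + 1) = sales z τ m + if z (τ + m) = true then 1 else 0 :=
  Finset.sum_range_succ _ _

lemma invariant_init (hK : 0 < K) (hD0 : ∀ i, 0 ≤ D i) (hD1 : ∀ i, D i ≤ 1) (ho : o < 2 ^ L) :
    Invariant L K D S o y (initState L) 0 0 where
  cnt_lt := by
    have := Node.rounds_pos hK (rootNode L)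
    change 0 < 2 * (rootNode L).rounds K
    omega
  counts := ⟨0, rfl, by simp [initState, sales], by simp [initState, sales]⟩
  valid := by
    intro ν hν
    have : ν = rootNode L := by simpa [initState] using hν
    subst this
    exact ⟨by simp [rootNode], le_rfl, hD0 _, by simp [rootNode]⟩
  covers := ⟨rootNode L, by simp [initState], Nat.zero_le _, by
    simp only [Node.last, rootNode]; omega, by
    simpa [Node.upper, Node.width, rootNode] using hD1 o⟩
  index_le := by simp [initState]
  energy := by simp [initState]

lemma Invariant.record_counts {s : State} {t : ℕ} {E : ℝ} (h : Invariant L K D S o y s t E) :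
    ∃ τ, τ + s.cnt = t ∧
      (s.record K (y (s.query K) t)).sa =
        sales (y s.cur.probe) τ (min (s.cnt + 1) (s.cur.rounds K)) ∧
      (s.record K (y (s.query K) t)).sb =
        sales (y s.cur.last) (τ + s.cur.rounds K) (s.cnt + 1 - s.cur.rounds K) := by
  obtain ⟨τ, ht, h1, h2⟩ := h.counts
  refine ⟨τ, ht, ?_, ?_⟩
  · by_cases hc : s.cnt < s.cur.rounds K
    · rw [min_eq_left hc.le] at h1
      rw [min_eq_left hc, sales_succ, ht]
      simp [State.record, State.query, hc, h1]
    · rw [min_eq_right (by omega)] at h1 ⊢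
      simp [State.record, hc, h1]
  · by_cases hc : s.cnt < s.cur.rounds K
    · rw [Nat.sub_eq_zero_of_le hc.le] at h2
      rw [Nat.sub_eq_zero_of_le hc]
      simp [State.record, hc, h2]
    · have e1 : s.cnt + 1 - s.cur.rounds K = s.cnt - s.cur.rounds K + 1 := by omega
      have e2 : τ + s.cur.rounds K + (s.cnt - s.cur.rounds K) = t := by omega
      rw [e1, sales_succ, e2]
      simp [State.record, State.query, hc, h2]

lemma Invariant.step (hK : 0 < K) (hD : Antitone D) (hD0 : ∀ i, 0 ≤ D i)
    (hS : ∀ i j, D j < D i → ∃ s ∈ S, (i : ℝ) / 2 ^ L ≤ s ∧ s < (j : ℝ) / 2 ^ L)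
    (ho : ∀ i < 2 ^ L, i * D i ≤ o * D o) (hy : Accurate L K D y)
    {s : State} {t : ℕ} {E : ℝ} (ht : t < 2 ^ L) (h : Invariant L K D S o y s t E) :
    Invariant L K D S o y (s.step L K (y (s.query K) t)) (t + 1) (E + s.cur.width ^ 2) := by
  obtain ⟨τ, hτ, h1, h2⟩ := h.record_counts
  unfold State.step
  split_ifs with hc
  · refine ⟨hc, ⟨τ, ?_, h1, h2⟩, h.valid, h.covers, h.index_le, ?_⟩
    · change τ + (s.cnt + 1) = t + 1
      omega
    · have := h.energy
      change E + s.cur.width ^ 2 + 2 * K * (((s.cur :: s.rest).map (Node.potential L S)).sum : ℕ)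
        ≤ 2 * K * (rootNode L).potential L S + ((s.cnt + 1 : ℕ) : ℝ) * s.cur.width ^ 2
      push_cast at this ⊢
      linarith
  · have hcnt : s.cnt + 1 = 2 * s.cur.rounds K := by have := h.cnt_lt; omega
    have hm := Node.rounds_pos hK s.cur
    have hcur := h.valid _ List.mem_cons_self
    -- A test completed within `2 ^ L` rounds has `4 ^ level ≤ 2 ^ L`, which keeps levels at most `L
    -- + 1` after refinement.
    have h4 : 4 ^ s.cur.level ≤ s.cur.rounds K := Nat.le_mul_of_pos_left _ hK
    have hr : s.cur.level < 2 ^ L :=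
      (Nat.lt_pow_self (by norm_num : 1 < 4)).trans_le (by omega)
    have hl : s.cur.level ≤ L := by
      have : 2 ^ s.cur.level ≤ 2 ^ L :=
        (Nat.pow_le_pow_left (by norm_num : 2 ≤ 4) _).trans (by omega)
      exact (Nat.pow_le_pow_iff_right (by norm_num)).1 this
    rw [hcnt, min_eq_right (by omega)] at h1
    have e : 2 * s.cur.rounds K - s.cur.rounds K = s.cur.rounds K := by omega
    rw [hcnt, e] at h2
    have ha := hy s.cur.probe ((Node.probe_le_last hcur.base_nonneg).trans_lt hcur.last_lt) τ
      (by omega) s.cur.level hr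
    have hb := hy s.cur.last hcur.last_lt (τ + s.cur.rounds K) (by omega) s.cur.level hr
    change |(sales (y s.cur.probe) τ (s.cur.rounds K) : ℝ) - s.cur.rounds K * _| ≤
      s.cur.rounds K * (s.cur.width / 8) at ha
    change |(sales (y s.cur.last) _ (s.cur.rounds K) : ℝ) - s.cur.rounds K * _| ≤
      s.cur.rounds K * (s.cur.width / 8) at hb
    rw [← h1] at ha
    rw [← h2] at hb
    set sa := (s.record K (y (s.query K) t)).sa
    set sb := (s.record K (y (s.query K) t)).sb
    have hcov : ∃ ν ∈ s.cur.refine K sa sb ++ s.rest, ν.Covers D o := by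
      obtain ⟨ν, hν, hνc⟩ := h.covers
      rcases List.mem_cons.1 hν with rfl | hν
      · obtain ⟨μ, hμ, hμc⟩ := Node.exists_covers_refine hK hD hcur (ho _ hcur.last_lt) hνc ha hb
        exact ⟨μ, List.mem_append_left _ hμ, hμc⟩
      · exact ⟨ν, List.mem_append_right _ hν, hνc⟩
    have hpot := Node.potential_refine hK hD hS hl ha hb
    obtain ⟨hp, hmax, hc0, ha0, hb0⟩ := restart_spec L (s.cur.refine K sa sb ++ s.rest) (by
      obtain ⟨ν, hν, -⟩ := hcov
      exact List.ne_nil_of_mem hν)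
    refine ⟨?_, ⟨t + 1, by omega, ?_, ?_⟩, ?_, ?_, hmax, ?_⟩
    · have := Node.rounds_pos hK (restart L (s.cur.refine K sa sb ++ s.rest)).cur
      omega
    · rw [ha0, hc0]; simp [sales]
    · rw [hb0, hc0]; simp [sales]
    · intro ν hν
      rcases List.mem_append.1 (hp.mem_iff.1 hν) with hν | hν
      · exact Node.valid_of_mem_refine hK hD hD0 hcur hl ha hb ν hν
      · exact h.valid ν (List.mem_cons_of_mem _ hν)
    · obtain ⟨ν, hν, hνc⟩ := hcov
      exact ⟨ν, hp.mem_iff.2 hν, hνc⟩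
    · have hen := h.energy
      rw [(hp.map _).sum_eq, List.map_append, List.sum_append, hc0]
      rw [List.map_cons, List.sum_cons] at hen
      have hw := Node.rounds_mul_width_sq K s.cur
      have hcnt' : (s.cnt : ℝ) = 2 * s.cur.rounds K - 1 := by
        have : (s.cnt : ℝ) + 1 = 2 * s.cur.rounds K := by exact_mod_cast hcnt
        linarith
      rw [hcnt'] at hen
      have hpot' : ((((s.cur.refine K sa sb).map (Node.potential L S)).sum : ℕ) : ℝ) + 1 ≤
          (s.cur.potential L S : ℕ) := by exact_mod_cast hpot
      have hKr : (0 : ℝ) < K := by exact_mod_cast hK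
      have := mul_le_mul_of_nonneg_left hpot' hKr.le
      push_cast at hen this ⊢
      linarith

/-- Optimism: the covering node bounds the optimal utility by its index, and the current node has
the largest index. -/
lemma Invariant.loss (hD : Antitone D) {s : State} {t : ℕ} {E : ℝ}
    (h : Invariant L K D S o y s t E) :
    o * D o - s.query K * D (s.query K) ≤ 2 ^ L * (2 * s.cur.width) ∧ s.query K < 2 ^ L := by
  have hcur := h.valid _ List.mem_cons_self
  have hidx : o * D o ≤ s.cur.index := by
    obtain ⟨ν, hν, hνc⟩ := h.covers
    have hv := h.valid ν hν
    have h1 : o * D o ≤ ν.index := by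
      have h1 : (o : ℝ) ≤ ν.last := by exact_mod_cast hνc.le_last
      have := Node.upper_pos hv.base_nonneg
      exact (mul_le_mul_of_nonneg_left hνc.le_upper (Nat.cast_nonneg _)).trans
        (mul_le_mul_of_nonneg_right h1 this.le)
    rcases List.mem_cons.1 hν with rfl | hν
    · exact h1
    · exact h1.trans (h.index_le ν hν)
  unfold State.query
  split_ifs
  · exact ⟨by linarith [hcur.probe_loss hD],
      (Node.probe_le_last hcur.base_nonneg).trans_lt hcur.last_lt⟩
  · exact ⟨by linarith [hcur.last_loss], hcur.last_lt⟩

/-- The unfinished test costs at most `2 * K`, covered by the current node's remaining potential,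
which is at least 1. -/
lemma Invariant.energy_le {s : State} {t : ℕ} {E : ℝ} (h : Invariant L K D S o y s t E) :
    E ≤ 2 * K * (rootNode L).potential L S := by
  have hen := h.energy
  have hw := Node.rounds_mul_width_sq K s.cur
  have hv := h.valid _ List.mem_cons_self
  have h1 : (1 : ℝ) ≤ (((s.cur :: s.rest).map (Node.potential L S)).sum : ℕ) := by
    have h3 : 1 ≤ s.cur.potential L S := by
      have := hv.level_le
      exact Nat.mul_pos (by omega) (by omega)
    rw [List.map_cons, List.sum_cons]
    exact_mod_cast h3.trans (Nat.le_add_right _ _)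
  have h2 : (s.cnt : ℝ) * s.cur.width ^ 2 ≤ 2 * s.cur.rounds K * s.cur.width ^ 2 := by
    have : (s.cnt : ℝ) ≤ 2 * s.cur.rounds K := by exact_mod_cast h.cnt_lt.le
    gcongr
  have h3 := mul_le_mul_of_nonneg_left h1 (Nat.cast_nonneg (α := ℝ) K)
  linarith

/-- Total loss of a run of the algorithm, in grid units. -/
lemma sum_loss_le (hK : 0 < K) (hD : Antitone D) (hD0 : ∀ i, 0 ≤ D i) (hD1 : ∀ i, D i ≤ 1)
    (hS : ∀ i j, D j < D i → ∃ s ∈ S, (i : ℝ) / 2 ^ L ≤ s ∧ s < (j : ℝ) / 2 ^ L)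
    (ho' : o < 2 ^ L) (ho : ∀ i < 2 ^ L, i * D i ≤ o * D o) (hy : Accurate L K D y)
    (σ : ℕ → State) (hσ0 : σ 0 = initState L)
    (hσ : ∀ t, σ (t + 1) = (σ t).step L K (y ((σ t).query K) t)) {T : ℕ} (hT : T ≤ 2 ^ L) :
    (∀ t < T, (σ t).query K < 2 ^ L) ∧
    ∑ t ∈ Finset.range T, (o * D o - (σ t).query K * D ((σ t).query K)) ≤
      2 ^ L * (2 * √(T * (2 * K * ((L + 2) * (1 + 2 * L * S.card))))) := by
  have hinv : ∀ t ≤ T, Invariant L K D S o y (σ t) t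
      (∑ s ∈ Finset.range t, (σ s).cur.width ^ 2) := by
    intro t
    induction t with
    | zero => intro _; rw [hσ0]; simpa using invariant_init hK hD0 hD1 ho'
    | succ t ih =>
      intro ht
      rw [hσ, Finset.sum_range_succ]
      exact (ih (by omega)).step hK hD hD0 hS ho hy (by omega)
  refine ⟨fun t ht => ((hinv t ht.le).loss hD).2, ?_⟩
  have hE := (hinv T le_rfl).energy_le
  have hpot : ((rootNode L).potential L S : ℝ) ≤ (L + 2) * (1 + 2 * L * S.card) := by
    have : (rootNode L).potential L S ≤ (L + 2) * (1 + 2 * L * S.card) := by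
      change (L + 2 - 0) * (1 + 2 * L * (rootNode L).jumps L S) ≤ _
      rw [Nat.sub_zero]
      gcongr
      exact Finset.card_filter_le _ _
    exact_mod_cast this
  calc _ ≤ ∑ t ∈ Finset.range T, 2 ^ L * (2 * (σ t).cur.width) :=
        Finset.sum_le_sum fun t ht => ((hinv t (Finset.mem_range.1 ht).le).loss hD).1
    _ = 2 ^ L * (2 * ∑ t ∈ Finset.range T, (σ t).cur.width) := by
        rw [← Finset.mul_sum, ← Finset.mul_sum]
    _ ≤ _ := by
      gcongr
      apply Real.le_sqrt_of_sq_le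
      calc _ ≤ (T : ℝ) * ∑ t ∈ Finset.range T, (σ t).cur.width ^ 2 := by
            simpa using sq_sum_le_card_mul_sum_sq (s := Finset.range T)
              (f := fun t => (σ t).cur.width)
        _ ≤ _ := by
          gcongr
          exact hE.trans (by gcongr)

end Run

/-! ### Demand on the grid and discretisation error -/

open ProbabilityTheory

/-- The demand at the grid price `i / 2 ^ L`. -/
noncomputable def demand (V : PMF ℝ) (L i : ℕ) : ℝ :=
  V.toMeasure.real (Set.Ici ((i : ℝ) / 2 ^ L))

/-- The grid price `i / 2 ^ L`. -/
noncomputable def gridPrice (L i : ℕ) : unitInterval :=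
  Set.projIcc 0 1 zero_le_one ((i : ℝ) / 2 ^ L)

lemma coe_gridPrice {L i : ℕ} (h : i ≤ 2 ^ L) : (gridPrice L i : ℝ) = (i : ℝ) / 2 ^ L := by
  have h' : (i : ℝ) ≤ 2 ^ L := by exact_mod_cast h
  unfold gridPrice
  rw [Set.projIcc_of_mem zero_le_one (x := (i : ℝ) / 2 ^ L)
    ⟨by positivity, (div_le_one (by positivity)).2 h'⟩]

lemma demand_antitone (V : PMF ℝ) (L : ℕ) : Antitone (demand V L) := fun i j h =>
  measureReal_mono (Set.Ici_subset_Ici.2 (by gcongr))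

lemma demand_nonneg (V : PMF ℝ) (L i : ℕ) : 0 ≤ demand V L i := measureReal_nonneg

lemma demand_le_one (V : PMF ℝ) (L i : ℕ) : demand V L i ≤ 1 := measureReal_le_one

lemma utility_gridPrice (V : PMF ℝ) {L i : ℕ} (h : i ≤ 2 ^ L) :
    utility V (gridPrice L i) = (i : ℝ) / 2 ^ L * demand V L i := by
  rw [utility, coe_gridPrice h, demand]

lemma exists_support_of_demand_lt (V : PMF ℝ) (L : ℕ) {i j : ℕ}
    (h : demand V L j < demand V L i) :
    ∃ s ∈ V.support, (i : ℝ) / 2 ^ L ≤ s ∧ s < (j : ℝ) / 2 ^ L := by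
  by_contra! hc
  have h0 : V.toMeasure (Set.Ico ((i : ℝ) / 2 ^ L) ((j : ℝ) / 2 ^ L)) = 0 := by
    rw [PMF.toMeasure_apply_eq_zero_iff _ measurableSet_Ico, Set.disjoint_left]
    intro s hs h1
    exact absurd h1.2 (not_lt.2 (hc s hs h1.1))
  have h1 : demand V L i ≤ V.toMeasure.real
      (Set.Ico ((i : ℝ) / 2 ^ L) ((j : ℝ) / 2 ^ L) ∪ Set.Ici ((j : ℝ) / 2 ^ L)) := by
    refine measureReal_mono fun s hs => ?_
    rcases lt_or_ge s ((j : ℝ) / 2 ^ L) with h | h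
    · exact Or.inl ⟨hs, h⟩
    · exact Or.inr h
  have h2 := h1.trans (measureReal_union_le _ _)
  rw [measureReal_def, h0, ENNReal.toReal_zero, zero_add] at h2
  exact absurd h (not_lt.2 h2)

lemma utility_nonneg (V : PMF ℝ) (p : unitInterval) : 0 ≤ utility V p :=
  mul_nonneg p.2.1 measureReal_nonneg

lemma utility_le_one (V : PMF ℝ) (p : unitInterval) : utility V p ≤ 1 :=
  mul_le_one₀ p.2.2 measureReal_nonneg measureReal_le_one

lemma OPT_le_one (V : PMF ℝ) : OPT V ≤ 1 := ciSup_le (utility_le_one V)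

/-- The best grid price is optimal up to the mesh of the grid. -/
lemma OPT_le_of_grid_optimal (V : PMF ℝ) {L o : ℕ}
    (ho : ∀ i < 2 ^ L, i * demand V L i ≤ o * demand V L o) :
    OPT V ≤ (o * demand V L o + 1) / 2 ^ L := by
  refine ciSup_le fun p => ?_
  have hL : (0 : ℝ) < 2 ^ L := by positivity
  obtain ⟨i, hi, h1, h2⟩ : ∃ i : ℕ, i < 2 ^ L ∧ (i : ℝ) ≤ p * 2 ^ L ∧ p * 2 ^ L ≤ (i : ℝ) + 1 := by
    have hp0 : 0 ≤ (p : ℝ) * 2 ^ L := mul_nonneg p.2.1 hL.le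
    have hp1 : (p : ℝ) * 2 ^ L ≤ 2 ^ L := mul_le_of_le_one_left hL.le p.2.2
    rcases lt_or_ge ⌊(p : ℝ) * 2 ^ L⌋₊ (2 ^ L) with h | h
    · exact ⟨_, h, Nat.floor_le hp0, (Nat.lt_floor_add_one _).le⟩
    -- Only `p = 1` reaches this case, as the grid stops at `2 ^ L - 1`.
    · have h3 : (2 : ℝ) ^ L ≤ p * 2 ^ L := by
        have := (Nat.le_floor_iff hp0).1 h
        exact_mod_cast this
      have h4 : 1 ≤ 2 ^ L := Nat.one_le_two_pow
      refine ⟨2 ^ L - 1, by omega, ?_, ?_⟩ <;>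
      · rw [Nat.cast_sub h4]
        push_cast
        linarith
  rw [le_div_iff₀ hL]
  have hD : V.toMeasure.real (Set.Ici (p : ℝ)) ≤ demand V L i :=
    measureReal_mono (Set.Ici_subset_Ici.2 ((div_le_iff₀ hL).2 h1))
  have hD1 : V.toMeasure.real (Set.Ici (p : ℝ)) ≤ 1 := measureReal_le_one
  have hD0 : 0 ≤ V.toMeasure.real (Set.Ici (p : ℝ)) := measureReal_nonneg
  have := ho i hi
  unfold utility
  nlinarith [Nat.cast_nonneg (α := ℝ) i]

/-! ### The policy and measurability of its histories -/

/-- The state reached after a history. -/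
noncomputable def stateOf (L K : ℕ) (H : History) : State :=
  H.foldr (fun e s => s.step L K e.2) (initState L)

/-- The policy of the algorithm. -/
noncomputable def policy (L K : ℕ) : Policy := fun H => gridPrice L ((stateOf L K H).query K)

/-- Whether a buyer with valuation `v t` buys at the `i`-th grid price. -/
noncomputable def buys (L : ℕ) (v : ℕ → ℝ) (i t : ℕ) : Bool :=
  decide ((gridPrice L i : ℝ) ≤ v t)

lemma stateOf_history_succ (L K : ℕ) (v : ℕ → ℝ) (t : ℕ) :
    stateOf L K (history (policy L K) v (t + 1)) =
      (stateOf L K (history (policy L K) v t)).step L K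
        (buys L v ((stateOf L K (history (policy L K) v t)).query K) t) := rfl

/-- Quantifying over all sets of histories makes the induction work: conditions on the next price
pull back to sets of shorter histories, and no σ-algebra on histories is needed. -/
lemma measurableSet_history (π : Policy) (t : ℕ) (s : Set History) :
    MeasurableSet {v : ℕ → ℝ | history π v t ∈ s} := by
  induction t generalizing s with
  | zero => exact MeasurableSet.const ([] ∈ s)
  | succ t ih =>
    have hm : Measurable fun v : ℕ → ℝ => (π (history π v t) : ℝ) := fun A _ =>
      ih {H | (π H : ℝ) ∈ A}
    have hle : MeasurableSet {v : ℕ → ℝ | (π (history π v t) : ℝ) ≤ v t} :=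
      measurableSet_le hm (measurable_pi_apply t)
    have heq : {v : ℕ → ℝ | history π v (t + 1) ∈ s} =
        ({v | history π v t ∈ {H | (π H, true) :: H ∈ s}} ∩ {v | (π (history π v t) : ℝ) ≤ v t}) ∪
        ({v | history π v t ∈ {H | (π H, false) :: H ∈ s}} ∩
          {v | (π (history π v t) : ℝ) ≤ v t}ᶜ) := by
      ext v
      by_cases h : (π (history π v t) : ℝ) ≤ v t <;> simp [history, h]
    rw [heq]
    exact ((ih _).inter hle).union ((ih _).inter hle.compl)

lemma measurable_utility_price (π : Policy) (V : PMF ℝ) (t : ℕ) :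
    Measurable fun v : ℕ → ℝ => utility V (price π v t) := fun A _ =>
  measurableSet_history π t {H | utility V (π H) ∈ A}

lemma regret_eq_integral (π : Policy) (V : PMF ℝ) (T : ℕ) :
    Integrable (fun v : ℕ → ℝ => ∑ t ∈ Finset.range T, (OPT V - utility V (price π v t)))
      (Measure.infinitePi fun _ : ℕ => V.toMeasure) ∧
    regret π V T = ∫ v, ∑ t ∈ Finset.range T, (OPT V - utility V (price π v t))
      ∂(Measure.infinitePi fun _ : ℕ => V.toMeasure) := by
  have hi : Integrable (fun v : ℕ → ℝ => ∑ t ∈ Finset.range T, utility V (price π v t))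
      (Measure.infinitePi fun _ : ℕ => V.toMeasure) := by
    refine integrable_finsetSum _ fun t _ => ?_
    exact Integrable.of_mem_Icc 0 1 (measurable_utility_price π V t).aemeasurable
      (Filter.Eventually.of_forall fun v => ⟨utility_nonneg _ _, utility_le_one _ _⟩)
  have he : (fun v : ℕ → ℝ => ∑ t ∈ Finset.range T, (OPT V - utility V (price π v t))) =
      fun v => T * OPT V - ∑ t ∈ Finset.range T, utility V (price π v t) := by
    funext v; simp
  rw [he]
  refine ⟨(integrable_const _).sub hi, ?_⟩
  rw [integral_sub (integrable_const _) hi]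
  simp [regret]

/-! ### Concentration of the sales counts -/

/-- Hoeffding's inequality for the number of sales at a grid price in a window of rounds. -/
lemma measure_sales_deviation_le (V : PMF ℝ) {L i : ℕ} (hi : i ≤ 2 ^ L) (τ m : ℕ) {ε : ℝ}
    (hε : 0 ≤ ε) :
    (Measure.infinitePi fun _ : ℕ => V.toMeasure).real
      {v | ε < |(sales (buys L v i) τ m : ℝ) - m * demand V L i|} ≤
        2 * Real.exp (-ε ^ 2 / (2 * m * (1 / 4))) := by
  set μ := Measure.infinitePi fun _ : ℕ => V.toMeasure with hμ
  set f : ℝ → ℝ := Set.indicator (Set.Ici ((i : ℝ) / 2 ^ L)) 1 with hf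
  have hfm : Measurable f := measurable_one.indicator measurableSet_Ici
  set X : ℕ → (ℕ → ℝ) → ℝ := fun j v => f (v (τ + j)) - demand V L i with hX
  have hmean (t : ℕ) : ∫ v, f (v t) ∂μ = demand V L i := by
    have h1 := (measurePreserving_eval_infinitePi (fun _ : ℕ => V.toMeasure) t)
    have h2 : ∫ v, f (v t) ∂μ = ∫ x, f x ∂(V.toMeasure) := by
      rw [← h1.map_eq, integral_map h1.measurable.aemeasurable hfm.aestronglyMeasurable]
    rw [h2, hf, integral_indicator_one measurableSet_Ici, demand]
  have hind : iIndepFun X μ := by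
    have h1 : iIndepFun (fun (t : ℕ) (v : ℕ → ℝ) => f (v t) - demand V L i) μ :=
      iIndepFun_infinitePi (P := fun _ : ℕ => V.toMeasure) (X := fun _ x => f x - demand V L i)
        fun _ => hfm.sub_const _
    exact h1.precomp (add_right_injective τ)
  have hsub (j : ℕ) : HasSubgaussianMGF (X j) (1 / 4) μ := by
    have h1 := hasSubgaussianMGF_of_mem_Icc (μ := μ) (X := fun v => f (v (τ + j))) (a := 0)
      (b := 1) (hfm.comp (measurable_pi_apply _)).aemeasurable
      (Filter.Eventually.of_forall fun v => by
        simp only [hf, Set.indicator_apply]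
        split_ifs <;> simp)
    rw [hmean] at h1
    have h2 : (‖(1 : ℝ) - 0‖₊ / 2) ^ 2 = 1 / 4 := by
      rw [sub_zero, nnnorm_one, div_pow]; norm_num
    rwa [h2] at h1
  have hind' : iIndepFun (fun j => -X j) μ :=
    hind.comp (fun _ x => -x) fun _ => measurable_neg
  have hsum (v : ℕ → ℝ) : ∑ j ∈ Finset.range m, X j v =
      (sales (buys L v i) τ m : ℝ) - m * demand V L i := by
    simp only [hX, Finset.sum_sub_distrib, Finset.sum_const, Finset.card_range, nsmul_eq_mul]
    congr 1
    unfold sales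
    push_cast
    refine Finset.sum_congr rfl fun j _ => ?_
    simp [hf, Set.indicator_apply, buys, coe_gridPrice hi]
  have hu := HasSubgaussianMGF.measure_sum_range_ge_le_of_iIndepFun hind (n := m)
    (fun j _ => hsub j) hε
  have hl := HasSubgaussianMGF.measure_sum_range_ge_le_of_iIndepFun hind' (n := m)
    (fun j _ => (hsub j).neg) hε
  have hc : (((1 / 4 : NNReal)) : ℝ) = 1 / 4 := by norm_num
  rw [hc] at hu hl
  rw [two_mul]
  refine le_trans ?_ (add_le_add hu hl)
  refine le_trans (measureReal_mono fun v hv => ?_) (measureReal_union_le _ _)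
  have hv' : ε < |(sales (buys L v i) τ m : ℝ) - m * demand V L i| := hv
  rw [← hsum] at hv'
  rcases lt_abs.1 hv' with h | h
  · exact Or.inl h.le
  · refine Or.inr ?_
    change ε ≤ ∑ j ∈ Finset.range m, -X j v
    rw [Finset.sum_neg_distrib]
    exact h.le

/-- The accuracy requirement fails with small probability. -/
lemma exists_measurableSet_accurate (V : PMF ℝ) (L K : ℕ) (hK : 0 < K) :
    ∃ B : Set (ℕ → ℝ), MeasurableSet B ∧ (∀ v ∉ B, Accurate L K (demand V L) (buys L v)) ∧
      (Measure.infinitePi fun _ : ℕ => V.toMeasure).real B ≤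
        (2 ^ L) ^ 3 * (2 * Real.exp (-(K / 32 : ℝ))) := by
  set μ := Measure.infinitePi fun _ : ℕ => V.toMeasure with hμ
  set R := Finset.range (2 ^ L) with hR
  set F : ℕ × ℕ × ℕ → Set (ℕ → ℝ) := fun q =>
    {v | ((K * 4 ^ q.2.2 : ℕ) : ℝ) * ((1 / 2) ^ q.2.2 / 8) <
      |(sales (buys L v q.1) q.2.1 (K * 4 ^ q.2.2) : ℝ) - (K * 4 ^ q.2.2 : ℕ) * demand V L q.1|}
    with hF
  -- Measurable hulls have the same measure as the bad events, so their measurability need not be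
  -- checked.
  refine ⟨⋃ q ∈ R ×ˢ R ×ˢ R, toMeasurable μ (F q), ?_, ?_, ?_⟩
  · exact Finset.measurableSet_biUnion _ fun q _ => measurableSet_toMeasurable _ _
  · intro v hv i hi τ hτ r hr
    by_contra hc
    refine hv (Set.mem_biUnion (x := (i, τ, r)) ?_ (subset_toMeasurable μ _ (not_le.1 hc)))
    simp [hR, hi, hτ, hr]
  · refine (measureReal_biUnion_finset_le _ _).trans ?_
    refine (Finset.sum_le_card_nsmul _ _ (2 * Real.exp (-(K / 32 : ℝ))) fun q hq => ?_).trans ?_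
    · rw [measureReal_def, measure_toMeasurable, ← measureReal_def]
      have hq1 : q.1 < 2 ^ L := by
        have := (Finset.mem_product.1 hq).1
        simpa [hR] using this
      refine (measure_sales_deviation_le V hq1.le q.2.1 (K * 4 ^ q.2.2) (by positivity)).trans_eq ?_
      -- As `m * width ^ 2 = K` for a window of length `m`, the exponent is `-K / 32` at every
      -- level.
      congr 2
      have hKr : (K : ℝ) ≠ 0 := by positivity
      have h4 : ((4 : ℝ) ^ q.2.2) ≠ 0 := by positivity
      have h2 : (((1 : ℝ) / 2) ^ q.2.2) ^ 2 = 1 / 4 ^ q.2.2 := by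
        rw [← pow_mul, mul_comm, pow_mul, ← one_div_pow]; norm_num
      push_cast
      rw [mul_pow, div_pow, h2]
      field_simp
      norm_num
    · simp only [Finset.card_product, hR, Finset.card_range, nsmul_eq_mul]
      push_cast
      apply le_of_eq
      ring

/-! ### The regret bound -/

/-- Regret of the policy when its parameters dominate the horizon. -/
lemma regret_policy_le {T L : ℕ} (hT : T ≤ 2 ^ L) (V : PMF ℝ) (hV : V.support.Finite) :
    regret (policy L (128 * (L + 1))) V T ≤
      2 + 2 * √(T * (2 * (128 * (L + 1)) * ((L + 2) * (1 + 2 * L * V.support.ncard)))) := by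
  set K := 128 * (L + 1) with hKdef
  have hK : 0 < K := by omega
  have hL : (0 : ℝ) < 2 ^ L := by positivity
  have hTL : (T : ℝ) ≤ 2 ^ L := by exact_mod_cast hT
  obtain ⟨o, ho', ho⟩ := Finset.exists_max_image (Finset.range (2 ^ L))
    (fun i : ℕ => (i : ℝ) * demand V L i) ⟨0, by simp⟩
  simp only [Finset.mem_range] at ho' ho
  obtain ⟨B, hBm, hB, hBp⟩ := exists_measurableSet_accurate V L K hK
  obtain ⟨hint, heq⟩ := regret_eq_integral (policy L K) V T
  set W := √(T * (2 * (128 * (L + 1)) * ((L + 2) * (1 + 2 * L * V.support.ncard)))) with hW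
  have hpt (v : ℕ → ℝ) : ∑ t ∈ Finset.range T, (OPT V - utility V (price (policy L K) v t)) ≤
      (1 + 2 * W) + B.indicator (fun _ => (T : ℝ)) v := by
    by_cases hv : v ∈ B
    · rw [Set.indicator_of_mem hv]
      have h1 : ∑ t ∈ Finset.range T, (OPT V - utility V (price (policy L K) v t)) ≤
          ∑ t ∈ Finset.range T, (1 : ℝ) := Finset.sum_le_sum fun t _ => by
        linarith [OPT_le_one V, utility_nonneg V (price (policy L K) v t)]
      have h2 : 0 ≤ W := Real.sqrt_nonneg _
      simp only [Finset.sum_const, Finset.card_range, nsmul_eq_mul, mul_one] at h1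
      linarith
    · rw [Set.indicator_of_notMem hv, add_zero]
      obtain ⟨hq, hs⟩ := sum_loss_le (S := hV.toFinset) hK (demand_antitone V L)
        (demand_nonneg V L) (demand_le_one V L)
        (fun i j h => by simpa using exists_support_of_demand_lt V L h) ho' ho (hB v hv)
        (fun t => stateOf L K (history (policy L K) v t)) rfl
        (stateOf_history_succ L K v) hT
      rw [← Set.ncard_eq_toFinset_card _ hV] at hs
      have hOPT := OPT_le_of_grid_optimal V ho
      have h1 : ∑ t ∈ Finset.range T, (OPT V - utility V (price (policy L K) v t)) ≤
          ∑ t ∈ Finset.range T, (1 / 2 ^ L + (o * demand V L o -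
            (stateOf L K (history (policy L K) v t)).query K *
              demand V L ((stateOf L K (history (policy L K) v t)).query K)) / 2 ^ L) := by
        refine Finset.sum_le_sum fun t ht => ?_
        have := hq t (Finset.mem_range.1 ht)
        have hu : utility V (price (policy L K) v t) = _ := utility_gridPrice V this.le
        rw [hu, sub_div, div_mul_eq_mul_div]
        rw [add_div] at hOPT
        linarith
      refine h1.trans ?_
      rw [Finset.sum_add_distrib]
      have h2 : ∑ t ∈ Finset.range T, (1 : ℝ) / 2 ^ L ≤ 1 := by
        simp only [Finset.sum_const, Finset.card_range, nsmul_eq_mul]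
        rw [mul_one_div]
        exact (div_le_one hL).2 hTL
      refine add_le_add h2 ?_
      rw [← Finset.sum_div, div_le_iff₀ hL]
      refine hs.trans_eq ?_
      rw [hW, hKdef]
      push_cast
      ring
  -- With `K = 128 * (L + 1)` the exponential is at most `2 ^ (-4 * (L + 1))`, beating the `2 ^ (3 *
  -- L)` windows and the worst-case loss `T ≤ 2 ^ L`.
  have hprob : (T : ℝ) * (Measure.infinitePi fun _ : ℕ => V.toMeasure).real B ≤ 1 := by
    have hexp : Real.exp (-(K / 32 : ℝ)) ≤ (1 / 2) ^ (4 * (L + 1)) := by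
      have h1 : (-(K / 32 : ℝ)) = ((4 * (L + 1) : ℕ) : ℝ) * (-1) := by
        rw [hKdef]; push_cast; ring
      rw [h1, Real.exp_nat_mul]
      refine pow_le_pow_left₀ (Real.exp_pos _).le ?_ _
      rw [Real.exp_neg, one_div]
      exact inv_anti₀ (by norm_num) (by linarith [Real.add_one_le_exp (1 : ℝ)])
    calc _ ≤ (2 : ℝ) ^ L * ((2 ^ L) ^ 3 * (2 * (1 / 2) ^ (4 * (L + 1)))) := by
          refine mul_le_mul hTL (hBp.trans ?_) measureReal_nonneg hL.le
          gcongr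
      _ = ((2 : ℝ) ^ L) ^ 4 * ((1 / 2) ^ L) ^ 4 * (1 / 8) := by
          rw [mul_add, pow_add, mul_comm 4 L, pow_mul (1 / 2 : ℝ) L 4]; ring
      _ ≤ 1 := by
          rw [← mul_pow, ← mul_pow]; norm_num
  rw [heq]
  have hi2 : Integrable (B.indicator fun _ => (T : ℝ))
      (Measure.infinitePi fun _ : ℕ => V.toMeasure) := (integrable_const _).indicator hBm
  refine (integral_mono hint ((integrable_const _).add hi2) hpt).trans ?_
  rw [integral_add' (integrable_const _) hi2, integral_indicator_const _ hBm]
  simp only [integral_const, probReal_univ, smul_eq_mul]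
  linarith

lemma clog_two_le {T : ℕ} (hT : 1 ≤ T) : (Nat.clog 2 T : ℝ) ≤ 2 * (1 + Real.log T) := by
  have hlog : 0 ≤ Real.log T := Real.log_natCast_nonneg T
  rcases Nat.eq_zero_or_pos (Nat.clog 2 T) with h | h
  · rw [h, Nat.cast_zero]; positivity
  · have hT2 : 1 < T := by
      by_contra hc
      have : T = 1 := by omega
      subst this
      simp at h
    have h1 := Nat.pow_pred_clog_lt_self (b := 2) (by norm_num) hT2
    have h2 : ((2 : ℝ) ^ (Nat.clog 2 T - 1)) ≤ T := by exact_mod_cast h1.le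
    have h3 := Real.log_le_log (by positivity) h2
    rw [Real.log_pow, Nat.cast_sub h] at h3
    have h4 := Real.log_two_gt_d9
    have h5 : (1 : ℝ) ≤ Nat.clog 2 T := by exact_mod_cast h
    push_cast at h3
    nlinarith

end PostedPrice

/-- The algorithm receives only the horizon `T`; neither it nor the constants `C`, `k` depend on
the valuation distribution `V` or on the number `n` of its support points. -/
theorem mainTheorem5 :
    ∃ (A : ℕ → PostedPrice.Policy) (C : ℝ) (k : ℕ),
      ∀ (T : ℕ), 1 ≤ T →
        ∀ (n : ℕ) (V : PMF ℝ), V.support ⊆ Set.Ioo (0 : ℝ) 1 → V.support.encard = (n : ℕ∞) →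
          PostedPrice.regret (A T) V T ≤
            C * Real.sqrt ((n : ℝ) * (T : ℝ)) * (1 + Real.log (T : ℝ)) ^ k := by
  -- `250 = 2 * 124 + 2`: the root is at most `124 * l ^ 2 * √(n * T)` with `l = 1 + log T`, and the
  -- additive 2 is absorbed since `√(n * T) * l ^ 2 ≥ 1`.
  refine ⟨fun T => PostedPrice.policy (Nat.clog 2 T) (128 * (Nat.clog 2 T + 1)), 250, 2, ?_⟩
  intro T hT n V _ hn
  have hfin : V.support.Finite := Set.finite_of_encard_eq_coe hn
  have hcard : V.support.ncard = n := by rw [Set.ncard, hn, ENat.toNat_natCast]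
  have hn1 : (1 : ℝ) ≤ n := by
    rw [← hcard]
    exact_mod_cast (Set.ncard_pos hfin).2 V.support_nonempty
  have hT1 : (1 : ℝ) ≤ T := by exact_mod_cast hT
  have hreg := PostedPrice.regret_policy_le (Nat.le_pow_clog (by norm_num : 1 < 2) T) V hfin
  rw [hcard] at hreg
  refine hreg.trans ?_
  have hL := PostedPrice.clog_two_le hT
  have hL0 : (0 : ℝ) ≤ Nat.clog 2 T := Nat.cast_nonneg _
  have hl1 : 1 ≤ 1 + Real.log T := by linarith [Real.log_natCast_nonneg T]
  set l := 1 + Real.log (T : ℝ) with hl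
  set c := (Nat.clog 2 T : ℝ) with hc
  -- `124 ^ 2 = 15376` is the first square above `256 * 3 * 4 * 5 = 15360`.
  have hprod : 2 * (128 * (c + 1)) * ((c + 2) * (1 + 2 * c * n)) ≤ n * (124 * l ^ 2) ^ 2 := by
    have h1 : 1 + 2 * c * n ≤ 5 * (n * l) := by nlinarith
    calc _ ≤ 2 * (128 * (3 * l)) * ((4 * l) * (5 * (n * l))) := by
          gcongr <;> linarith
      _ = 15360 * n * (l ^ 3 * 1) := by ring
      _ ≤ 15376 * n * (l ^ 3 * l) := by gcongr; norm_num
      _ = _ := by ring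
  have hsq : √(T * (2 * (128 * (c + 1)) * ((c + 2) * (1 + 2 * c * n)))) ≤
      √(n * T) * (124 * l ^ 2) := by
    rw [← Real.sqrt_sq (by positivity : (0 : ℝ) ≤ 124 * l ^ 2), ← Real.sqrt_mul (by positivity)]
    apply Real.sqrt_le_sqrt
    calc _ ≤ (T : ℝ) * (n * (124 * l ^ 2) ^ 2) := by gcongr
      _ = _ := by ring
  have h1 : 1 ≤ √((n : ℝ) * T) * l ^ 2 :=
    one_le_mul_of_one_le_of_one_le (Real.one_le_sqrt.2 (one_le_mul_of_one_le_of_one_le hn1 hT1))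
      (one_le_pow₀ hl1)
  linarith
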